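/- A queue machine is a six-tuple $M=(Q,\Sigma,\Gamma,\$,s,\delta)$ where $Q$ is a finite set of states, $\Gamma$ is a finite queue alphabet, $\Sigma\subset\Gamma$ is the input alphabet, $\$\in\Gamma\setminus\Sigma$ is the initial queue symbol, $s\in Q$ is the start state, and $\delta: Q\times\Gamma\to Q\times\Gamma^*$ is the transition function. A configuration is a pair $(q,\gamma)\in Q\times\Gamma^*$ (current state and queue content), and $(p,A\alpha)\to_M(q,\alpha\gamma)$ whenever $\delta(p,A)=(q,\gamma)$; $\to_M^*$ is the reflexive and transitive closure of $\to_M$. On input $x\in\Sigma^*$ the machine starts in $(s,x\$)$. It terminates on $x$ if it reaches a configuration without successor, equivalently if $(s,x\$)\to_M^*(q,\varepsilon)$ for some $q\in Q$. It is bound on $x$ if there is a $k\in\mathbb{N}$ such that $|\gamma|\le k$ for all $q,\gamma$ with $(s,x\$)\to_M^*(q,\gamma)$. **Lemma.** Given a queue machine $M$ and an input $x$, it is undecidable whether $M$ does not terminate and is bound on $x$. That is, no algorithm, given (a finite description of) an arbitrary queue machine $M$ and an input $x\in\Sigma^*$, decides whether both $M$ does not terminate on $x$ and $M$ is bound on $x$.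 -/

import Mathlib

/-- A queue machine `(Q, Σ, Γ, $, s, δ)` with state set `Q` and queue alphabet `Γ`. Both are meant
to be finite; below, decision problems are posed for `Q = Fin n` and `Γ = Fin m`. -/
structure QueueMachine (Q Γ : Type*) where
  /-- the input alphabet `Σ ⊂ Γ` -/
  inputAlphabet : Finset Γ
  /-- the initial queue symbol `$` -/
  initSymbol : Γ
  initSymbol_notMem : initSymbol ∉ inputAlphabet
  /-- the start state `s` -/
  start : Q
  /-- the transition function -/
  δ : Q × Γ → Q × List Γ

namespace QueueMachine

section Semantics

variable {Q Γ : Type*} (M : QueueMachine Q Γ)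

/-- `(p, Aα) → (q, αγ)` whenever `δ (p, A) = (q, γ)`. -/
inductive Step : Q × List Γ → Q × List Γ → Prop
  | mk (p : Q) (A : Γ) (α : List Γ) (q : Q) (γ : List Γ) (h : M.δ (p, A) = (q, γ)) :
      Step (p, A :: α) (q, α ++ γ)

/-- The reflexive and transitive closure of `Step`. -/
def Reaches : Q × List Γ → Q × List Γ → Prop :=
  Relation.ReflTransGen M.Step

/-- The starting configuration `(s, x$)` on input `x`. -/
def startConfig (x : List Γ) : Q × List Γ :=
  (M.start, x ++ [M.initSymbol])

/-- `M` accepts `x` if its run on `x` empties the queue. -/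
def Accepts (x : List Γ) : Prop :=
  ∃ q, M.Reaches (M.startConfig x) (q, [])

/-- `M` terminates on `x` if its run on `x` blocks, that is, reaches a configuration without
successor. -/
def TerminatesOn (x : List Γ) : Prop :=
  ∃ c, M.Reaches (M.startConfig x) c ∧ ∀ c', ¬ M.Step c c'

/-- `M` is bound on `x` if the length of the queue is bounded along the run on `x`. -/
def BoundedOn (x : List Γ) : Prop :=
  ∃ k : ℕ, ∀ q γ, M.Reaches (M.startConfig x) (q, γ) → γ.length ≤ k

/-- A queue machine blocks exactly by emptying the queue. -/
theorem terminatesOn_iff_accepts (x : List Γ) : M.TerminatesOn x ↔ M.Accepts x := by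
  constructor
  · rintro ⟨⟨q, γ⟩, hr, hb⟩
    cases γ with
    | nil => exact ⟨q, hr⟩
    | cons A α => exact absurd (Step.mk q A α _ _ rfl) (hb _)
  · rintro ⟨q, hr⟩
    exact ⟨_, hr, fun c' h => by cases h⟩

end Semantics

/-- Finite descriptions of queue machines: number of states, number of queue symbols, list of
input symbols, initial queue symbol, start state, and the table of the transition function (one row
per state, in it one entry per queue symbol). -/
abbrev Description : Type :=
  ℕ × ℕ × List ℕ × ℕ × ℕ × List (List (ℕ × List ℕ))

/-- The description of a queue machine with states `0, …, n - 1` and symbols `0, …, m - 1`. -/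
def describe {n m : ℕ} (M : QueueMachine (Fin n) (Fin m)) : Description :=
  (n, m, (M.inputAlphabet.sort (· ≤ ·)).map Fin.val, M.initSymbol.val, M.start.val,
    List.ofFn fun q => List.ofFn fun a => ((M.δ (q, a)).1.val, (M.δ (q, a)).2.map Fin.val))

/-- The description determines the machine. -/
theorem describe_injective :
    Function.Injective fun M : (Σ n m : ℕ, QueueMachine (Fin n) (Fin m)) => M.2.2.describe := by
  rintro ⟨n, m, M⟩ ⟨n', m', M'⟩ h
  simp only [describe, Prod.mk.injEq] at h
  obtain ⟨rfl, rfl, hS, hi, hs, hδ⟩ := h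
  obtain ⟨S, i, hi', s, d⟩ := M
  obtain ⟨S', i', hi'', s', d'⟩ := M'
  have e1 : S = S' := by
    have := (List.map_injective_iff.2 Fin.val_injective) hS
    simpa using congrArg List.toFinset this
  have e2 : i = i' := Fin.val_injective hi
  have e3 : s = s' := Fin.val_injective hs
  have e4 : d = d' := by
    funext ⟨q, a⟩
    have h1 := congrFun (List.ofFn_injective (congrFun (List.ofFn_injective hδ) q)) a
    simp only [Prod.mk.injEq] at h1
    exact Prod.ext (Fin.val_injective h1.1) ((List.map_injective_iff.2 Fin.val_injective) h1.2)
  subst e1 e2 e3 e4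
  rfl

end QueueMachine

/-! The proof reduces a halting problem to boundedness. A universal partial recursive code `c`, for
which halting on `[i]` is undecidable in `i`, is compiled by `PartrecToTM2` to a machine with
finitely many stacks, and one fixed queue machine simulates that machine.

The queue, read cyclically from a mark, interleaves all stacks: the symbols tagged `k`, in order,
form the stack `k`. The mark doubles as `$` and is put back whenever it is read, so the simulator
never terminates and only boundedness matters.

A diverging stack machine may use bounded space, so each jump to a label also inserts a padding
symbol that is never removed. Divergence then makes the queue grow forever (`ofStack_step`), whereas
after a halt every symbol is merely rotated. Hence the queue is bounded iff `c` halts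
(`ofStack_boundedFrom_iff`). Only the input depends on `i`, so the reduction is computable once the
encoding of `i` is. -/

open Turing Relation

namespace QueueMachine

/-! ### Runs of a queue machine -/

section General

variable {Q Γ : Type*} (M : QueueMachine Q Γ)

theorem step_cons_iff {p : Q} {A : Γ} {α : List Γ} {c : Q × List Γ} :
    M.Step (p, A :: α) c ↔ c = ((M.δ (p, A)).1, α ++ (M.δ (p, A)).2) := by
  constructor
  · rintro ⟨_, _, _, q, γ, h⟩
    rw [h]
  · rintro rfl
    exact .mk p A α _ _ rfl

theorem Step.unique {c d d' : Q × List Γ} (h : M.Step c d) (h' : M.Step c d') : d = d' := by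
  obtain ⟨p, _ | ⟨A, α⟩⟩ := c
  · cases h
  · rw [step_cons_iff] at h h'
    rw [h, h']

/-- Symbols on which the state `p` acts as the identity are moved to the end of the queue. -/
theorem reaches_rotate (p : Q) (w u : List Γ) (h : ∀ a ∈ w, M.δ (p, a) = (p, [a])) :
    M.Reaches (p, w ++ u) (p, u ++ w) := by
  induction w generalizing u with
  | nil =>
    rw [List.append_nil]
    exact ReflTransGen.refl
  | cons a w ih =>
    have h1 : M.Step (p, a :: w ++ u) (p, w ++ (u ++ [a])) := by
      rw [List.cons_append, step_cons_iff, h a (by simp)]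
      simp
    have h2 := ih (u ++ [a]) fun b hb => h b (by simp [hb])
    have h3 : M.Reaches _ _ := ReflTransGen.head h1 h2
    simpa using h3

/-- A common bound on the queue lengths of all configurations reachable from `c`. -/
def BoundedFrom (c : Q × List Γ) : Prop :=
  ∃ k : ℕ, ∀ d, M.Reaches c d → d.2.length ≤ k

theorem boundedOn_iff (x : List Γ) : M.BoundedOn x ↔ M.BoundedFrom (M.startConfig x) := by
  simp [BoundedOn, BoundedFrom]

/-- Runs are deterministic, so a step back adds just one configuration to the reachable ones. -/
theorem BoundedFrom.of_reaches {c d : Q × List Γ} (h : M.Reaches c d) (hd : M.BoundedFrom d) :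
    M.BoundedFrom c := by
  induction h using ReflTransGen.head_induction_on with
  | refl => exact hd
  | @head a b hab _ ih =>
    obtain ⟨k, hk⟩ := ih
    refine ⟨max k a.2.length, fun e he => ?_⟩
    rcases ReflTransGen.cases_head he with rfl | ⟨b', hb', hr⟩
    · exact le_max_right _ _
    · obtain rfl := Step.unique M hab hb'
      exact (hk e hr).trans (le_max_left _ _)

/-- A symbol that is put back whenever it is read never leaves the queue. -/
theorem mem_of_reaches {A : Γ} (hA : ∀ p, A ∈ (M.δ (p, A)).2) {c d : Q × List Γ}
    (h : M.Reaches c d) (hc : A ∈ c.2) : A ∈ d.2 := by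
  induction h with
  | refl => exact hc
  | tail _ hs ih =>
    obtain ⟨p, B, α, q, γ, hδ⟩ := hs
    rcases List.mem_cons.1 ih with rfl | h
    · have := hA p
      rw [hδ] at this
      exact List.mem_append_right _ this
    · exact List.mem_append_left _ h

theorem not_terminatesOn_of_mem (hA : ∀ p, M.initSymbol ∈ (M.δ (p, M.initSymbol)).2)
    (x : List Γ) : ¬ M.TerminatesOn x := by
  rw [terminatesOn_iff_accepts]
  rintro ⟨q, hq⟩
  simpa using M.mem_of_reaches hA hq (by simp [startConfig])

end General

/-! ### Renaming states and symbols -/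

section Transport

variable {Q Γ Q' Γ' : Type*} {M : QueueMachine Q Γ} {N : QueueMachine Q' Γ'}

theorem step_map_iff {f : Q' → Q} {e : Γ' → Γ}
    (h : ∀ p a, M.δ (f p, e a) = (f (N.δ (p, a)).1, (N.δ (p, a)).2.map e))
    {c : Q' × List Γ'} {d : Q × List Γ} :
    M.Step (f c.1, c.2.map e) d ↔ ∃ c', N.Step c c' ∧ (f c'.1, c'.2.map e) = d := by
  obtain ⟨p, _ | ⟨A, α⟩⟩ := c
  · constructor
    · intro h
      cases h
    · rintro ⟨_, h, _⟩
      cases h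
  · simp [step_cons_iff, h, eq_comm]

theorem reaches_map_iff {f : Q' → Q} {e : Γ' → Γ}
    (h : ∀ p a, M.δ (f p, e a) = (f (N.δ (p, a)).1, (N.δ (p, a)).2.map e))
    {c : Q' × List Γ'} {d : Q × List Γ} :
    M.Reaches (f c.1, c.2.map e) d ↔ ∃ c', N.Reaches c c' ∧ (f c'.1, c'.2.map e) = d := by
  constructor
  · intro hr
    induction hr with
    | refl => exact ⟨c, .refl, rfl⟩
    | tail _ hs ih =>
      obtain ⟨c', hc', rfl⟩ := ih
      obtain ⟨c'', hs', rfl⟩ := (step_map_iff h).1 hs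
      exact ⟨c'', hc'.tail hs', rfl⟩
  · rintro ⟨c', hr, rfl⟩
    induction hr with
    | refl => exact .refl
    | tail _ hs ih => exact ih.tail ((step_map_iff h).2 ⟨_, hs, rfl⟩)

theorem boundedFrom_map_iff {f : Q' → Q} {e : Γ' → Γ}
    (h : ∀ p a, M.δ (f p, e a) = (f (N.δ (p, a)).1, (N.δ (p, a)).2.map e))
    (c : Q' × List Γ') : M.BoundedFrom (f c.1, c.2.map e) ↔ N.BoundedFrom c := by
  refine exists_congr fun k => ⟨fun H d hd => ?_, fun H d hd => ?_⟩
  · simpa using H _ ((reaches_map_iff h).2 ⟨d, hd, rfl⟩)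
  · obtain ⟨c', hc', rfl⟩ := (reaches_map_iff h).1 hd
    simpa using H c' hc'

/-- A queue machine whose transitions stay inside a finite set of states is, up to renaming of
states and symbols, a machine with states `Fin n` and symbols `Fin m`. -/
theorem exists_fin [Finite Γ] (M : QueueMachine Q Γ) {T : Set Q} (hT : T.Finite)
    (hs : M.start ∈ T) (hδ : ∀ p ∈ T, ∀ a, (M.δ (p, a)).1 ∈ T) :
    ∃ (n m : ℕ) (N : QueueMachine (Fin n) (Fin m)) (f : Fin n → Q) (e : Γ ≃ Fin m),
      f N.start = M.start ∧ N.initSymbol = e M.initSymbol ∧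
      (∀ a, e a ∈ N.inputAlphabet ↔ a ∈ M.inputAlphabet) ∧
      ∀ p a, M.δ (f p, e.symm a) = (f (N.δ (p, a)).1, (N.δ (p, a)).2.map e.symm) := by
  obtain ⟨m, ⟨e⟩⟩ := Finite.exists_equiv_fin Γ
  have := hT.to_subtype
  obtain ⟨n, ⟨t⟩⟩ := Finite.exists_equiv_fin T
  refine ⟨n, m,
    { inputAlphabet := M.inputAlphabet.map e.toEmbedding
      initSymbol := e M.initSymbol
      initSymbol_notMem := by simpa using M.initSymbol_notMem
      start := t ⟨M.start, hs⟩
      δ := fun pa => (t ⟨_, hδ (t.symm pa.1) (t.symm pa.1).2 (e.symm pa.2)⟩,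
        (M.δ (t.symm pa.1, e.symm pa.2)).2.map e) },
    fun p => t.symm p, e, ?_, rfl, ?_, ?_⟩
  · simp
  · simp
  · intro p a
    simp

end Transport

/-! ### Stacks stored in a queue -/

section Simulation

variable {K G Λ σ : Type*}

/-- Statements of a machine with stacks indexed by `K`, all over the alphabet `G`. -/
abbrev StackStmt (K G Λ σ : Type*) : Type _ := TM2.Stmt (fun _ : K => G) Λ σ

/-- Queue symbols for the simulation of stacks: the mark `none` in front of the queue, the padding
symbol `some none`, and for each stack `k` the symbols `some (some (k, g))`. -/
abbrev StackSymbol (K G : Type*) : Type _ := Option (Option (K × G))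

/-- States for the simulation of stacks: the statement to be executed, the local store, and
whether a search for the top symbol of the stack has started. -/
abbrev StackState (K G Λ σ : Type*) : Type _ := StackStmt K G Λ σ × σ × Bool

/-- The transition on reading the mark. -/
def onMark (M : Λ → StackStmt K G Λ σ) :
    StackStmt K G Λ σ → σ → Bool → StackState K G Λ σ × List (StackSymbol K G)
  | .push k f q, v, _ => ((q, v, false), [none, some (some (k, f v))])
  | .peek k f q, v, false => ((.peek k f q, v, true), [none])
  -- Meeting the mark during a search means that the whole queue has been passed: the stack is
  -- empty.
  | .peek _ f q, v, true => ((q, f v none, false), [none])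
  | .pop k f q, v, false => ((.pop k f q, v, true), [none])
  | .pop _ f q, v, true => ((q, f v none, false), [none])
  | .load a q, v, _ => ((q, a v, false), [none])
  | .branch p q₁ q₂, v, _ => ((cond (p v) q₁ q₂, v, false), [none])
  | .goto l, v, _ => ((M (l v), v, false), [none, some none])
  | .halt, v, b => ((.halt, v, b), [none])

/-- Keeps the state set finite: a jump stays in the support `S`, and any other statement passes to a
substatement or to itself. -/
theorem onMark_mem_stmts {M : Λ → StackStmt K G Λ σ} {S : Finset Λ} (hS : ∀ l ∈ S, TM2.SupportsStmt S (M l))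
    {q : StackStmt K G Λ σ} (hq : some q ∈ TM2.stmts M S) (v : σ) (b : Bool) :
    some (onMark M q v b).1.1 ∈ TM2.stmts M S := by
  cases q with
  | goto l =>
    have hmem : ∀ l ∈ S, some (M l) ∈ TM2.stmts M S := fun l hl => by
      simp only [TM2.stmts, Finset.some_mem_insertNone, Finset.mem_biUnion]
      exact ⟨l, hl, TM2.stmts₁_self⟩
    refine hmem _ ?_
    simp only [TM2.stmts, Finset.some_mem_insertNone, Finset.mem_biUnion] at hq
    obtain ⟨l', hl', hq⟩ := hq
    exact TM2.stmts₁_supportsStmt_mono hq (hS l' hl') v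
  | halt => exact hq
  | branch p q₁ q₂ =>
    refine TM2.stmts_trans ?_ hq
    cases h : p v <;> simp [onMark, TM2.stmts₁, h, TM2.stmts₁_self]
  | _ =>
    refine TM2.stmts_trans ?_ hq
    cases b <;> simp [onMark, TM2.stmts₁, TM2.stmts₁_self]

variable [DecidableEq K]

/-- The content of the stack `k`. -/
def stackOf (k : K) (w : List (StackSymbol K G)) : List G :=
  w.filterMap fun a => a.bind fun b => b.bind fun c => if c.1 = k then some c.2 else none

/-- The number of padding symbols. -/
def padCount (w : List (StackSymbol K G)) : ℕ :=
  w.countP fun a => a.any Option.isNone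

@[simp]
theorem stackOf_nil (k : K) : stackOf k ([] : List (StackSymbol K G)) = [] := rfl

@[simp]
theorem stackOf_append (k : K) (w u : List (StackSymbol K G)) :
    stackOf k (w ++ u) = stackOf k w ++ stackOf k u :=
  List.filterMap_append

@[simp]
theorem stackOf_pad_cons (k : K) (w : List (StackSymbol K G)) :
    stackOf k (some none :: w) = stackOf k w := rfl

theorem stackOf_item_cons (k k' : K) (g : G) (w : List (StackSymbol K G)) :
    stackOf k (some (some (k', g)) :: w) =
      if k' = k then g :: stackOf k w else stackOf k w := by
  by_cases h : k' = k <;> simp [stackOf, h]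

theorem stackOf_map_item (k k₀ : K) (L : List G) :
    stackOf k (L.map fun g => some (some (k₀, g))) =
      Function.update (fun _ => ([] : List G)) k₀ L k := by
  induction L with
  | nil => by_cases h : k = k₀ <;> simp [Function.update, h]
  | cons g L ih =>
    rw [List.map_cons, stackOf_item_cons, ih]
    by_cases h : k = k₀
    · subst h
      simp
    · simp [h, Ne.symm h]

theorem stackOf_eq_cons {k : K} {w : List (StackSymbol K G)} {g : G} {gs : List G}
    (h : stackOf k w = g :: gs) :
    ∃ w₁ w₂, w = w₁ ++ some (some (k, g)) :: w₂ ∧ stackOf k w₁ = [] ∧ stackOf k w₂ = gs := by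
  obtain ⟨w₁, a, w₂, rfl, h₁, h₂, h₃⟩ := List.filterMap_eq_cons_iff.1 h
  refine ⟨w₁, w₂, ?_, List.filterMap_eq_nil_iff.2 h₁, h₃⟩
  obtain _ | _ | ⟨k', g'⟩ := a
  · simp at h₂
  · simp at h₂
  · by_cases hk : k' = k
    · simp [hk] at h₂
      simp [hk, h₂]
    · simp [hk] at h₂

theorem ne_of_stackOf_eq_nil {k : K} {w : List (StackSymbol K G)} (h : stackOf k w = [])
    {k' : K} {g : G} (hm : some (some (k', g)) ∈ w) : k' ≠ k := by
  rintro rfl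
  simpa using List.filterMap_eq_nil_iff.1 h _ hm

/-- The transition on reading a stack symbol while searching for the top of a stack. -/
def onItem (k' : K) (g : G) :
    StackStmt K G Λ σ → σ → StackState K G Λ σ × List (StackSymbol K G)
  | .peek k f q, v => if k' = k then ((q, f v (some g), false), [some (some (k', g))])
      else ((.peek k f q, v, true), [some (some (k', g))])
  | .pop k f q, v => if k' = k then ((q, f v (some g), false), [])
      else ((.pop k f q, v, true), [some (some (k', g))])
  | q, v => ((q, v, true), [some (some (k', g))])

theorem onItem_mem_stmts {M : Λ → StackStmt K G Λ σ} {S : Finset Λ} {q : StackStmt K G Λ σ} (hq : some q ∈ TM2.stmts M S)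
    (v : σ) (k : K) (g : G) : some (onItem k g q v).1.1 ∈ TM2.stmts M S := by
  refine TM2.stmts_trans ?_ hq
  cases q <;> simp only [onItem] <;> try split
  all_goals simp [TM2.stmts₁, TM2.stmts₁_self]

/-- The transition function simulating a stack machine. -/
def stackδ (M : Λ → StackStmt K G Λ σ) :
    StackState K G Λ σ × StackSymbol K G → StackState K G Λ σ × List (StackSymbol K G)
  | ((q, v, b), none) => onMark M q v b
  | ((q, v, true), some (some (k, g))) => onItem k g q v
  | (p, a) => (p, [a])

/-- The queue machine simulating a stack machine started at the label `l₀` with local store `v₀`. -/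
noncomputable def ofStack [Fintype K] [Fintype G] (M : Λ → StackStmt K G Λ σ) (l₀ : Λ) (v₀ : σ) :
    QueueMachine (StackState K G Λ σ) (StackSymbol K G) where
  inputAlphabet := by classical exact Finset.univ.erase none
  initSymbol := none
  initSymbol_notMem := by simp
  start := (M l₀, v₀, false)
  δ := stackδ M

/-- The queue configuration `d` represents the stack configuration `c` and holds at least `n`
padding symbols. -/
def Represents (M : Λ → StackStmt K G Λ σ) (n : ℕ) (c : TM2.Cfg (fun _ : K => G) Λ σ)
    (d : StackState K G Λ σ × List (StackSymbol K G)) : Prop :=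
  ∃ w : List (StackSymbol K G), none ∉ w ∧ (∀ k, stackOf k w = c.stk k) ∧
    d = ((c.l.elim .halt M, c.var, false), none :: w) ∧ n ≤ padCount w

theorem Represents.mono {M : Λ → StackStmt K G Λ σ} {m n : ℕ} (hmn : m ≤ n) {c : TM2.Cfg (fun _ : K => G) Λ σ}
    {d : StackState K G Λ σ × List (StackSymbol K G)} (h : Represents M n c d) :
    Represents M m c d := by
  obtain ⟨w, h₁, h₂, h₃, h₄⟩ := h
  exact ⟨w, h₁, h₂, h₃, hmn.trans h₄⟩

/-! ### Correctness of the simulation -/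

variable [Fintype K] [Fintype G] {M : Λ → StackStmt K G Λ σ} {l₀ : Λ} {v₀ : σ}

theorem mark_mem_ofStack_δ (p : StackState K G Λ σ) :
    none ∈ ((ofStack M l₀ v₀).δ (p, none)).2 := by
  obtain ⟨q, v, b⟩ := p
  cases q <;> cases b <;> simp [ofStack, stackδ, onMark]

/-- Outside of a search, the machine moves the mark to the front of the queue. -/
theorem ofStack_rotate (q : StackStmt K G Λ σ) (v : σ) {w : List (StackSymbol K G)}
    (hw : none ∉ w) (u : List (StackSymbol K G)) :
    (ofStack M l₀ v₀).Reaches ((q, v, false), w ++ u) ((q, v, false), u ++ w) := by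
  apply reaches_rotate
  rintro (_ | a) ha
  · exact absurd ha hw
  · cases a <;> rfl

/-- The mark and `u` are appended behind `w`. Rotating `w` past them leaves `u` directly after the
mark, which is why a pushed symbol lands on top of its stack. -/
theorem ofStack_onMark {q q' : StackStmt K G Λ σ} {v v' : σ} {u : List (StackSymbol K G)} {b : Bool}
    (h : onMark M q v b = ((q', v', false), none :: u)) {w : List (StackSymbol K G)}
    (hw : none ∉ w) :
    (ofStack M l₀ v₀).Reaches ((q, v, b), none :: w) ((q', v', false), none :: (u ++ w)) := by
  refine ReflTransGen.head (b := ((q', v', false), w ++ none :: u)) ?_ (ofStack_rotate q' v' hw _)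
  rw [step_cons_iff]
  simp [ofStack, stackδ, h]

/-- A search passes the symbols of other stacks. -/
theorem ofStack_search {q q' : StackStmt K G Λ σ} {k : K} {f : σ → Option G → σ} (v : σ)
    (hq : q = .peek k f q' ∨ q = .pop k f q') {w : List (StackSymbol K G)} (hw : none ∉ w)
    (hk : stackOf k w = []) (u : List (StackSymbol K G)) :
    (ofStack M l₀ v₀).Reaches ((q, v, true), w ++ u) ((q, v, true), u ++ w) := by
  apply reaches_rotate
  rintro (_ | _ | ⟨k', g⟩) ha
  · exact absurd ha hw
  · rfl
  · have := ne_of_stackOf_eq_nil hk ha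
    rcases hq with rfl | rfl <;> simp [ofStack, stackδ, onItem, this]

theorem ofStack_search_start {q q' : StackStmt K G Λ σ} {k : K} {f : σ → Option G → σ} (v : σ)
    (hq : q = .peek k f q' ∨ q = .pop k f q') (w : List (StackSymbol K G)) :
    (ofStack M l₀ v₀).Reaches ((q, v, false), none :: w) ((q, v, true), w ++ [none]) := by
  apply ReflTransGen.single
  rw [step_cons_iff]
  rcases hq with rfl | rfl <;> simp [ofStack, stackδ, onMark]

theorem ofStack_search_nil {q q' : StackStmt K G Λ σ} {k : K} {f : σ → Option G → σ} (v : σ)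
    (hq : q = .peek k f q' ∨ q = .pop k f q') {w : List (StackSymbol K G)} (hw : none ∉ w)
    (hk : stackOf k w = []) :
    (ofStack M l₀ v₀).Reaches ((q, v, false), none :: w) ((q', f v none, false), none :: w) := by
  refine (ofStack_search_start v hq w).trans ((ofStack_search v hq hw hk _).trans ?_)
  refine ofStack_onMark (u := []) ?_ hw
  rcases hq with rfl | rfl <;> rfl

/-- The symbol found is put back behind `w₁`, so rotating `w₂` restores the original cyclic order.
-/
theorem ofStack_peek_cons {q : StackStmt K G Λ σ} {k : K} {f : σ → Option G → σ} (v : σ)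
    {w₁ w₂ : List (StackSymbol K G)} (hw₁ : none ∉ w₁) (hw₂ : none ∉ w₂)
    (hk : stackOf k w₁ = []) (g : G) :
    (ofStack M l₀ v₀).Reaches ((.peek k f q, v, false), none :: (w₁ ++ some (some (k, g)) :: w₂))
      ((q, f v (some g), false), none :: (w₁ ++ some (some (k, g)) :: w₂)) := by
  have h₁ := ofStack_search_start (M := M) (l₀ := l₀) (v₀ := v₀) v (Or.inl (Eq.refl (TM2.Stmt.peek k f q)))
    (w₁ ++ some (some (k, g)) :: w₂)
  have h₂ := ofStack_search (M := M) (l₀ := l₀) (v₀ := v₀) v (Or.inl (Eq.refl (TM2.Stmt.peek k f q)))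
    hw₁ hk (some (some (k, g)) :: w₂ ++ [none])
  have h₃ : (ofStack M l₀ v₀).Step
      ((.peek k f q, v, true), some (some (k, g)) :: (w₂ ++ [none] ++ w₁))
      ((q, f v (some g), false), w₂ ++ ([none] ++ w₁ ++ [some (some (k, g))])) := by
    rw [step_cons_iff]
    simp [ofStack, stackδ, onItem]
  have h₄ := ofStack_rotate (M := M) (l₀ := l₀) (v₀ := v₀) q (f v (some g)) hw₂
    ([none] ++ w₁ ++ [some (some (k, g))])
  simp only [List.append_assoc, List.cons_append, List.nil_append] at h₁ h₂ h₃ h₄ ⊢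
  exact h₁.trans (h₂.trans (h₄.head h₃))

theorem ofStack_pop_cons {q : StackStmt K G Λ σ} {k : K} {f : σ → Option G → σ} (v : σ)
    {w₁ w₂ : List (StackSymbol K G)} (hw₁ : none ∉ w₁) (hw₂ : none ∉ w₂)
    (hk : stackOf k w₁ = []) (g : G) :
    (ofStack M l₀ v₀).Reaches ((.pop k f q, v, false), none :: (w₁ ++ some (some (k, g)) :: w₂))
      ((q, f v (some g), false), none :: (w₁ ++ w₂)) := by
  have h₁ := ofStack_search_start (M := M) (l₀ := l₀) (v₀ := v₀) v (Or.inr (Eq.refl (TM2.Stmt.pop k f q)))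
    (w₁ ++ some (some (k, g)) :: w₂)
  have h₂ := ofStack_search (M := M) (l₀ := l₀) (v₀ := v₀) v (Or.inr (Eq.refl (TM2.Stmt.pop k f q)))
    hw₁ hk (some (some (k, g)) :: w₂ ++ [none])
  have h₃ : (ofStack M l₀ v₀).Step
      ((.pop k f q, v, true), some (some (k, g)) :: (w₂ ++ [none] ++ w₁))
      ((q, f v (some g), false), w₂ ++ ([none] ++ w₁)) := by
    rw [step_cons_iff]
    simp [ofStack, stackδ, onItem]
  have h₄ := ofStack_rotate (M := M) (l₀ := l₀) (v₀ := v₀) q (f v (some g)) hw₂ ([none] ++ w₁)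
  simp only [List.append_assoc, List.cons_append, List.nil_append] at h₁ h₂ h₃ h₄ ⊢
  exact h₁.trans (h₂.trans (h₄.head h₃))

/-- Induction on the statement. Only `goto` changes the number of padding symbols, and a statement
executes exactly one `goto` unless it halts. -/
theorem ofStack_stepAux (q : StackStmt K G Λ σ) (v : σ) (S : K → List G)
    (w : List (StackSymbol K G)) (hw : none ∉ w) (hS : ∀ k, stackOf k w = S k) :
    ∃ d, (ofStack M l₀ v₀).Reaches ((q, v, false), none :: w) d ∧
      Represents M (padCount w + if (TM2.stepAux q v S).l.isSome then 1 else 0)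
        (TM2.stepAux q v S) d := by
  induction q generalizing v S w with
  | push k f q ih =>
    obtain ⟨d, hd, hr⟩ := ih v (Function.update S k (f v :: S k)) (some (some (k, f v)) :: w)
      (by simpa using hw) (fun k' => by
        rw [stackOf_item_cons]
        by_cases h : k = k'
        · subst h
          simp [hS]
        · simp [h, Ne.symm h, hS])
    refine ⟨d, (ofStack_onMark (u := [some (some (k, f v))]) rfl hw).trans hd, ?_⟩
    simpa [padCount] using hr
  | peek k f q ih =>
    obtain ⟨d, hd, hr⟩ := ih (f v (S k).head?) S w hw hS
    refine ⟨d, ReflTransGen.trans ?_ hd, hr⟩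
    rcases h : S k with _ | ⟨g, gs⟩
    · exact ofStack_search_nil v (Or.inl rfl) hw ((hS k).trans h)
    · obtain ⟨w₁, w₂, rfl, h₁, h₂⟩ := stackOf_eq_cons ((hS k).trans h)
      simp only [List.mem_append, List.mem_cons, not_or] at hw
      exact ofStack_peek_cons v hw.1 hw.2.2 h₁ g
  | pop k f q ih =>
    rcases h : S k with _ | ⟨g, gs⟩
    · obtain ⟨d, hd, hr⟩ := ih (f v (S k).head?) (Function.update S k (S k).tail) w hw (fun k' => by
        by_cases hk : k' = k
        · subst hk
          simp [hS, h]
        · simp [hk, hS])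
      refine ⟨d, ReflTransGen.trans ?_ hd, hr⟩
      rw [h]
      exact ofStack_search_nil v (Or.inr rfl) hw ((hS k).trans h)
    · obtain ⟨w₁, w₂, rfl, h₁, h₂⟩ := stackOf_eq_cons ((hS k).trans h)
      simp only [List.mem_append, List.mem_cons, not_or] at hw
      -- The removed symbol is the first one tagged `k`, so only the stack `k` changes.
      obtain ⟨d, hd, hr⟩ := ih (f v (S k).head?) (Function.update S k (S k).tail) (w₁ ++ w₂)
        (by simp [hw]) (fun k' => by
        have hk' := hS k'
        rw [stackOf_append, stackOf_item_cons] at hk'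
        by_cases hk : k' = k
        · subst hk
          simp [h, h₁, h₂]
        · simpa [hk, Ne.symm hk] using hk')
      refine ⟨d, ReflTransGen.trans ?_ hd, ?_⟩
      · rw [h]
        exact ofStack_pop_cons v hw.1 hw.2.2 h₁ g
      · simpa [padCount, List.countP_append] using hr
  | load a q ih =>
    obtain ⟨d, hd, hr⟩ := ih (a v) S w hw hS
    exact ⟨d, (ofStack_onMark (u := []) rfl hw).trans hd, hr⟩
  | branch p q₁ q₂ ih₁ ih₂ =>
    have h := ofStack_onMark (M := M) (l₀ := l₀) (v₀ := v₀) (q := .branch p q₁ q₂) (v := v)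
      (b := false) (u := []) rfl hw
    have hb : TM2.stepAux (.branch p q₁ q₂) v S = TM2.stepAux (cond (p v) q₁ q₂) v S := by
      cases hp : p v <;> simp [hp]
    rw [hb]
    revert h
    cases p v <;> intro h
    · obtain ⟨d, hd, hr⟩ := ih₂ v S w hw hS
      exact ⟨d, h.trans hd, hr⟩
    · obtain ⟨d, hd, hr⟩ := ih₁ v S w hw hS
      exact ⟨d, h.trans hd, hr⟩
  | goto l =>
    refine ⟨_, ofStack_onMark (u := [some none]) rfl hw, [some none] ++ w, by simpa using hw,
      fun k => ?_, rfl, ?_⟩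
    · simpa using hS k
    · simp [padCount]
  | halt => exact ⟨_, .refl, w, hw, hS, rfl, by simp⟩

/-- A step of the stack machine that does not lead to a halt adds a padding symbol. -/
theorem ofStack_step {n : ℕ} {c c' : TM2.Cfg (fun _ : K => G) Λ σ}
    {d : StackState K G Λ σ × List (StackSymbol K G)} (hd : Represents M n c d)
    (hc : TM2.step M c = some c') :
    ∃ d', (ofStack M l₀ v₀).Reaches d d' ∧
      Represents M (n + if c'.l.isSome then 1 else 0) c' d' := by
  obtain ⟨_ | l, v, S⟩ := c
  · simp at hc
  · obtain ⟨w, hw, hS, rfl, hn⟩ := hd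
    obtain rfl : TM2.stepAux (M l) v S = c' := by simpa using hc
    obtain ⟨d', h₁, h₂⟩ := ofStack_stepAux (M := M) (l₀ := l₀) (v₀ := v₀) (M l) v S w hw hS
    exact ⟨d', h₁, h₂.mono (by omega)⟩

/-! ### Boundedness of the queue and halting -/

theorem ofStack_boundedFrom_halt {v : σ} {w : List (StackSymbol K G)} :
    (ofStack M l₀ v₀).BoundedFrom ((.halt, v, false), w) := by
  refine ⟨w.length, fun d hd => ?_⟩
  suffices h : d.1 = (.halt, v, false) ∧ d.2.length = w.length from h.2.le
  induction hd with
  | refl => exact ⟨rfl, rfl⟩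
  | tail _ hs ih =>
    obtain ⟨p, A, α, q, γ, hδ⟩ := hs
    obtain ⟨rfl, hl⟩ := ih
    have h : (ofStack M l₀ v₀).δ ((.halt, v, false), A) = ((.halt, v, false), [A]) := by
      obtain _ | _ | _ := A <;> rfl
    rw [h] at hδ
    cases hδ
    simpa using hl

theorem ofStack_boundedFrom_iff {c : TM2.Cfg (fun _ : K => G) Λ σ}
    {d : StackState K G Λ σ × List (StackSymbol K G)} (hd : Represents M 0 c d) :
    (ofStack M l₀ v₀).BoundedFrom d ↔ (StateTransition.eval (TM2.step M) c).Dom := by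
  constructor
  · rintro ⟨k, hk⟩
    by_contra hdom
    have hne : ∀ c', StateTransition.Reaches (TM2.step M) c c' → TM2.step M c' ≠ none :=
      fun c' hr hn => hdom (Part.dom_iff_mem.2 ⟨c', StateTransition.mem_eval.2 ⟨hr, hn⟩⟩)
    have key : ∀ n, ∃ c' d', StateTransition.Reaches (TM2.step M) c c' ∧
        (ofStack M l₀ v₀).Reaches d d' ∧ Represents M n c' d' := by
      intro n
      induction n with
      | zero => exact ⟨c, d, .refl, .refl, hd⟩
      | succ n ih =>
        obtain ⟨c', d', hc', hd', hr⟩ := ih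
        obtain ⟨c'', hs⟩ := Option.ne_none_iff_exists'.1 (hne c' hc')
        obtain ⟨d'', hd'', hr'⟩ := ofStack_step (l₀ := l₀) (v₀ := v₀) hr hs
        have hc'' : StateTransition.Reaches (TM2.step M) c c'' := hc'.tail hs
        refine ⟨c'', d'', hc'', hd'.trans hd'', ?_⟩
        -- Without a label `c''` would have no successor, contrary to divergence; so this step did
        -- add a padding symbol.
        obtain ⟨_ | l, v, S⟩ := c''
        · exact absurd rfl (hne _ hc'')
        · exact hr'
    -- With `k` padding symbols and the mark, the queue is longer than `k`.
    obtain ⟨c', d', -, hd', w, -, -, rfl, hw⟩ := key k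
    have h₁ := hk _ hd'
    have h₂ : padCount w ≤ w.length := List.countP_le_length
    simp only [List.length_cons] at h₁
    omega
  · intro hdom
    obtain ⟨c', hc'⟩ := Part.dom_iff_mem.1 hdom
    obtain ⟨hr, hn⟩ := StateTransition.mem_eval.1 hc'
    have key : ∃ d', (ofStack M l₀ v₀).Reaches d d' ∧ Represents M 0 c' d' := by
      clear hc' hn
      induction hr with
      | refl => exact ⟨d, .refl, hd⟩
      | tail _ hs ih =>
        obtain ⟨d', hd', hr'⟩ := ih
        obtain ⟨d'', hd'', hr''⟩ := ofStack_step (l₀ := l₀) (v₀ := v₀) hr' hs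
        exact ⟨d'', hd'.trans hd'', hr''.mono (Nat.zero_le _)⟩
    obtain ⟨d', hd', hr'⟩ := key
    refine BoundedFrom.of_reaches _ hd' ?_
    obtain ⟨_ | l, v, S⟩ := c'
    · obtain ⟨w, -, -, rfl, -⟩ := hr'
      exact ofStack_boundedFrom_halt
    · simp at hn

theorem ofStack_boundedOn_iff (k₀ : K) (L : List G) :
    (ofStack M l₀ v₀).BoundedOn (L.map fun g => some (some (k₀, g))) ↔
      (StateTransition.eval (TM2.step M)
        ⟨some l₀, v₀, Function.update (fun _ => []) k₀ L⟩).Dom := by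
  set w : List (StackSymbol K G) := L.map fun g => some (some (k₀, g)) with hw
  have hw' : none ∉ w := by simp [hw]
  have hrot : (ofStack M l₀ v₀).Reaches ((ofStack M l₀ v₀).startConfig w)
      ((M l₀, v₀, false), none :: w) := ofStack_rotate (M l₀) v₀ hw' [none]
  have hrep : Represents M 0
      ⟨some l₀, v₀, Function.update (fun _ => []) k₀ L⟩ ((M l₀, v₀, false), none :: w) :=
    ⟨w, hw', fun k => stackOf_map_item k k₀ L, rfl, Nat.zero_le _⟩
  rw [← ofStack_boundedFrom_iff (l₀ := l₀) (v₀ := v₀) hrep, boundedOn_iff]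
  refine ⟨fun ⟨k, hk⟩ => ⟨k, fun d hd => hk d (hrot.trans hd)⟩, BoundedFrom.of_reaches _ hrot⟩

/-- Halting of a stack machine with finitely many labels is boundedness of a queue machine that
does not terminate on any input. -/
theorem exists_boundedOn_iff_dom [Finite σ] (M : Λ → StackStmt K G Λ σ) {S : Finset Λ}
    (hS : ∀ l ∈ S, TM2.SupportsStmt S (M l)) {l₀ : Λ} (hl₀ : l₀ ∈ S) (v₀ : σ) (k₀ : K) :
    ∃ (n m : ℕ) (N : QueueMachine (Fin n) (Fin m)) (e : G → Fin m), Function.Injective e ∧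
      (∀ g, e g ∈ N.inputAlphabet) ∧ ∀ L : List G, ¬ N.TerminatesOn (L.map e) ∧
        (N.BoundedOn (L.map e) ↔ (StateTransition.eval (TM2.step M)
          ⟨some l₀, v₀, Function.update (fun _ => []) k₀ L⟩).Dom) := by
  have hfin : {q : StackStmt K G Λ σ | some q ∈ TM2.stmts M S}.Finite :=
    (TM2.stmts M S).finite_toSet.preimage (Option.some_injective _).injOn
  obtain ⟨n, m, N, f, e, hs, hi, ha, hδ⟩ := exists_fin (ofStack M l₀ v₀)
    -- The type of all statements need not be finite; the statements occurring in the program on `S`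
    -- are.
    (T := {q | some q ∈ TM2.stmts M S} ×ˢ Set.univ) (hfin.prod Set.finite_univ)
    (by
      simp only [ofStack, Set.mem_prod, Set.mem_ofPred_eq, Set.mem_univ, and_true, TM2.stmts,
        Finset.some_mem_insertNone, Finset.mem_biUnion]
      exact ⟨l₀, hl₀, TM2.stmts₁_self⟩)
    (by
      rintro ⟨q, v, b⟩ hq a
      simp only [Set.mem_prod, Set.mem_ofPred_eq, Set.mem_univ, and_true] at hq ⊢
      obtain _ | _ | ⟨k, g⟩ := a
      · exact onMark_mem_stmts hS hq v b
      · cases b <;> exact hq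
      · cases b
        · exact hq
        · exact onItem_mem_stmts hq v k g)
  refine ⟨n, m, N, fun g => e (some (some (k₀, g))), fun g g' h => by simpa using h,
    fun g => by simp [ha, ofStack], fun L => ⟨?_, ?_⟩⟩
  · apply not_terminatesOn_of_mem
    intro p
    have h := hδ p N.initSymbol
    have hmem := mark_mem_ofStack_δ (M := M) (l₀ := l₀) (v₀ := v₀) (f p)
    rw [hi] at h ⊢
    rw [Equiv.symm_apply_apply] at h
    change (ofStack M l₀ v₀).δ (f p, none) = _ at h
    rw [h] at hmem
    obtain ⟨a, hmem, hae⟩ := List.mem_map.1 hmem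
    rw [Equiv.symm_apply_eq] at hae
    exact hae ▸ hmem
  · rw [← ofStack_boundedOn_iff k₀ L, boundedOn_iff, boundedOn_iff, ← boundedFrom_map_iff hδ]
    simp [startConfig, hs, hi, Function.comp_def]

end Simulation

end QueueMachine

/-! ### Computable input encoding and a universal code -/

namespace Turing.PartrecToTM2

/-- Binary increment with the least significant bit first; `r` carries the recursive increment of
the tail. -/
theorem trPosNum_succ (p : PosNum) : trPosNum p.succ =
    List.rec [Γ'.bit1] (fun a t r => if a = Γ'.bit0 then Γ'.bit1 :: t else Γ'.bit0 :: r)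
      (trPosNum p) := by
  induction p with
  | one => rfl
  | bit1 p ih => simp [PosNum.succ, trPosNum, ih]
  | bit0 p ih => simp [PosNum.succ, trPosNum]

theorem trNat_succ (n : ℕ) : trNat (n + 1) =
    List.rec [Γ'.bit1] (fun a t r => if a = Γ'.bit0 then Γ'.bit1 :: t else Γ'.bit0 :: r)
      (trNat n) := by
  have h : ((n + 1 : ℕ) : Num) = (n : Num).succ := by
    rw [Nat.cast_succ, Num.add_one]
  rw [trNat, trNat, h]
  cases (n : Num) with
  | zero => rfl
  | pos p => exact trPosNum_succ p

/-- The encoding of `n` is an `n`-fold binary increment, a list recursion. Injectivity of `e` lets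
the bit test be made on the images. -/
theorem primrec_map_trList_singleton {e : Γ' → ℕ} (he : Function.Injective e) :
    Primrec fun n : ℕ => (trList [n]).map e := by
  have h₁ : ∀ n, (trNat n).map e = Nat.rec [] (fun _ l => List.rec [e Γ'.bit1]
      (fun a t r => if a = e Γ'.bit0 then e Γ'.bit1 :: t else e Γ'.bit0 :: r) l) n := by
    intro n
    induction n with
    | zero => simp
    | succ n ih =>
      rw [trNat_succ]
      simp only
      rw [← ih]
      induction trNat n with
      | nil => rfl
      | cons a t ih =>
        by_cases ha : a = Γ'.bit0
        · simp [ha]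
        · simp only [ha, List.map_cons, he.eq_iff, if_false, ih]
  have h₂ : Primrec fun n => (trNat n).map e := by
    refine Primrec.of_eq ?_ fun n => (h₁ n).symm
    refine Primrec.nat_rec₁ _ ?_
    refine Primrec.list_rec (f := fun x : ℕ × List ℕ => x.2) (g := fun _ => [e Γ'.bit1])
      (h := fun _ y => if y.1 = e Γ'.bit0 then e Γ'.bit1 :: y.2.1 else e Γ'.bit0 :: y.2.2)
      Primrec.snd (Primrec.const _) ?_
    refine Primrec.ite (Primrec.eq.comp (Primrec.fst.comp Primrec.snd) (Primrec.const _)) ?_ ?_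
    · exact Primrec.list_cons.comp (Primrec.const _)
        (Primrec.fst.comp (Primrec.snd.comp Primrec.snd))
    · exact Primrec.list_cons.comp (Primrec.const _)
        (Primrec.snd.comp (Primrec.snd.comp Primrec.snd))
  refine (Primrec.list_append.comp h₂ (Primrec.const [e Γ'.cons])).of_eq fun n => ?_
  simp

instance : Fintype K' :=
  ⟨{.main, .rev, .aux, .stack}, fun k => by cases k <;> simp⟩

/-- A code for the universal function `i ↦ (code number i).eval 0` inherits undecidability from the
halting problem at input `0`. -/
theorem exists_code_not_computablePred_dom :
    ∃ c : ToPartrec.Code, ¬ ComputablePred fun n : ℕ => (c.eval [n]).Dom := by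
  have hp : Partrec fun n : ℕ => (Denumerable.ofNat Nat.Partrec.Code n).eval 0 :=
    Nat.Partrec.Code.eval_part.comp (Computable.ofNat _) (Computable.const 0)
  obtain ⟨c, hc⟩ := ToPartrec.Code.exists_code (Nat.Partrec'.part_iff₁.2 hp)
  refine ⟨c, fun h => ComputablePred.halting_problem 0 ?_⟩
  have hr := ComputablePred.computable_of_manyOneReducible
    (p := fun c : Nat.Partrec.Code => (c.eval 0).Dom) ⟨Encodable.encode, Computable.encode,
      fun c' => ?_⟩ h
  · exact hr
  · have := hc ⟨[Encodable.encode c'], rfl⟩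
    simp only at this
    rw [this]
    simp [List.Vector.head]

end Turing.PartrecToTM2

/-! ### The reduction -/

theorem mainTheorem7 :
    ¬ ∃ D : QueueMachine.Description × List ℕ → Prop, ComputablePred D ∧
      ∀ (n m : ℕ) (M : QueueMachine (Fin n) (Fin m)) (x : List (Fin m)),
        (∀ a ∈ x, a ∈ M.inputAlphabet) →
          (D (M.describe, x.map Fin.val) ↔ ¬ M.TerminatesOn x ∧ M.BoundedOn x) := by
  rintro ⟨D, hD, h⟩
  obtain ⟨c, hc⟩ := PartrecToTM2.exists_code_not_computablePred_dom
  have hsup := PartrecToTM2.tr_supports c .halt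
  obtain ⟨n, m, N, e, he, hin, hN⟩ := QueueMachine.exists_boundedOn_iff_dom PartrecToTM2.tr
    hsup.2 (l₀ := PartrecToTM2.trNormal c .halt) hsup.1 none .main
  refine hc (ComputablePred.computable_of_manyOneReducible ⟨fun i =>
    (N.describe, (PartrecToTM2.trList [i]).map fun a => (e a).val), ?_, fun i => ?_⟩ hD)
  · exact (Computable.const _).pair
      (PartrecToTM2.primrec_map_trList_singleton (Fin.val_injective.comp he)).to_comp
  · have h₁ := h n m N ((PartrecToTM2.trList [i]).map e)
      (List.forall_mem_map.2 fun a _ => hin a)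
    rw [List.map_map] at h₁
    refine Iff.trans ?_ h₁.symm
    rw [(hN _).2, and_iff_right (hN _).1]
    -- The compiled machine, started from `init c [i]`, halts exactly when `c.eval [i]` is defined.
    have h₂ := PartrecToTM2.tr_eval c [i]
    have h₃ : PartrecToTM2.init c [i] = ⟨some (PartrecToTM2.trNormal c .halt), none,
        Function.update (fun _ => []) .main (PartrecToTM2.trList [i])⟩ := by
      unfold PartrecToTM2.init
      congr 1
      funext k
      cases k <;> rfl
    rw [← h₃]
    exact (congrArg Part.Dom h₂).to_iff.symm
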